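/- Let $\mathbf p=(p_1,\dots,p_k)$ be a probability distribution with collision probability $C(\mathbf p)=\sum_{a=1}^k p_a^2$, and let $x_1,x_2,\dots$ be independent samples from $\mathbf p$. Given a null value $c_0\in\mathbb R$ and a confidence level $\delta\in(0,1]$ (but neither $\mathbf p$ nor any $\varepsilon$), the sequential tester draws $x_1,x_2,\dots$ one at a time, sets $$T_i=\sum_{j=1}^{i-1}\mathbf 1\{x_i=x_j\}-(i-1)c_0,$$ and rejects the null hypothesis at the first $i\ge 2$ for which $$\left|\frac{2}{i(i-1)}\sum_{j=1}^{i}T_j\right|>3.2\sqrt{\frac{\log\log i+0.72\log(20.8/\delta)}{i}}.$$ Let $N\in\{2,3,\dots\}\cup\{\infty\}$ be the number of samples observed when it rejects ($N=\infty$ if it never rejects). There is an absolute constant $K>0$ such that for all $k$, $\mathbf p$, $c_0$ and $\delta$ as above: (i) if $C(\mathbf p)=c_0$, then with probability at least $1-\delta$ the tester never rejects, i.e. $\Pr[N=\infty]\ge 1-\delta$; (ii) for every $\varepsilon\in(0,1]$ with $|C(\mathbf p)-c_0|\ge\varepsilon$, with probability at least $1-\delta$ the tester rejects after a finite number of samples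 $$N\le \frac{K}{\varepsilon^{2}}\,\max\!\left(1,\log\log\frac1\varepsilon\right)\max\!\left(1,\log\frac1\delta\right),$$ where $\max(1,\log\log\frac1\varepsilon)$ is read as $1$ when $\varepsilon = 1$. -/

import Mathlib

open MeasureTheory ProbabilityTheory

noncomputable section

/-- The collision probability `C(p) = ∑ i, p i ^ 2` of a discrete distribution `p`. -/
def collisionProb {k : ℕ} (p : Fin k → ℝ) : ℝ :=
  ∑ a, p a ^ 2

/-- `X 0, X 1, X 2, …` are independent samples from the distribution `p` on `Fin k`
(`X i` is the sample number `i + 1`). -/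
structure IsIIDSample {Ω : Type*} [MeasurableSpace Ω] {k : ℕ} (p : Fin k → ℝ)
    (X : ℕ → Ω → Fin k) (μ : Measure Ω) : Prop where
  measurable : ∀ i, Measurable (X i)
  indep : iIndepFun X μ
  law : ∀ i a, μ.real (X i ⁻¹' {a}) = p a

namespace SequentialTester

/-- The quantity the tester computes when it draws the sample `x i`, after the `i` samples
`x 0, …, x (i - 1)`: the number of collisions of `x i` with the earlier samples, minus `i * c₀`. -/
def increment {k : ℕ} (c₀ : ℝ) (x : ℕ → Fin k) (i : ℕ) : ℝ :=
  (∑ j ∈ Finset.range i, if x i = x j then (1 : ℝ) else 0) - i * c₀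

/-- The test statistic after `n` samples. -/
def statistic {k : ℕ} (c₀ : ℝ) (x : ℕ → Fin k) (n : ℕ) : ℝ :=
  2 / ((n : ℝ) * ((n : ℝ) - 1)) * ∑ i ∈ Finset.range n, increment c₀ x i

/-- The rejection threshold after `n` samples at confidence level `δ`. -/
def threshold (δ : ℝ) (n : ℕ) : ℝ :=
  3.2 * √((Real.log (Real.log n) + 0.72 * Real.log (20.8 / δ)) / n)

/-- The rejection condition after `n` samples. A single sample contains no pair, so that the
statistic is `0 / 0` and no test is made before the second sample. -/
def RejectCond {k : ℕ} (c₀ δ : ℝ) (x : ℕ → Fin k) (n : ℕ) : Prop :=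
  2 ≤ n ∧ threshold δ n < |statistic c₀ x n|

/-- The number of samples after which the tester, run with the inputs `c₀` and `δ` on the sample
sequence `x`, rejects the null hypothesis: the first `n` at which the rejection condition holds,
and `⊤` if the tester never rejects. -/
def rejectionTime {k : ℕ} (c₀ δ : ℝ) (x : ℕ → Fin k) : ℕ∞ :=
  ⨅ (n : ℕ) (_ : RejectCond c₀ δ x n), (n : ℕ∞)

end SequentialTester

end

/-!
The test statistic after `n` samples is `Uₙ - c₀`, where `Uₙ` (`collisionRate`) is the U-statistic
that estimates the collision probability `C(p)`. Both claims follow from one time-uniform bound: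
with probability at least `1 - δ`, the error `|Uₙ - C(p)|` is at most the rejection threshold for
all `n ≥ 2` at once (`IsIIDSample.one_sub_le_measure_forall_abs_sub_le_threshold`). Under the null
hypothesis this says that the tester never rejects. If `|C(p) - c₀| ≥ ε`, then on the same event
the tester has rejected by any time `n` at which the threshold is below `ε / 2`, and such an `n`
occurs within the announced number of samples (`exists_two_mul_threshold_lt`).

The time-uniform bound comes from a union bound over dyadic blocks of sample sizes. On a block that
starts at `2b`, Hoeffding's averaging trick writes every `Uₙ` as the mean, over all orderings of the
first `n` samples, of an average of `b` independent indicators (`collisionRate_eq_average`). By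
Jensen's inequality and exchangeability, `exp (s (Uₙ - C(p)))` behaves like a reversed submartingale
that ends at the exponential of that average, so that its maximum over the block obeys a Doob
inequality (`IsIIDSample.maximal_inequality`). Conditional expectations are not needed: the event
that `n` is the last time of the block with a large deviation is invariant under permutations of the
first `n` samples, and this is all that the argument uses. Hoeffding's lemma then bounds the
probability of a deviation of size `u` on the block by `2 exp (-2 b u ^ 2)`. With the threshold for
`u`, whose iterated logarithm is the logarithm of the block number, these probabilities are summable
over the blocks, with total at most `δ`.
-/

/-! ### Averaging over permutations -/

/-- The group of permutations acts transitively on pairs of distinct points, so that averaging over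
it turns the value of `f` at any one such pair into the mean of `f` over all of them. -/
theorem sum_perm_apply_pair {α : Type*} [Fintype α] [DecidableEq α] (f : α → α → ℝ)
    (hf : ∀ a, f a a = 0) {i j : α} (hij : i ≠ j) :
    (Fintype.card α : ℝ) * (Fintype.card α - 1) * ∑ σ : Equiv.Perm α, f (σ i) (σ j) =
      Fintype.card (Equiv.Perm α) * ∑ a, ∑ b, f a b := by
  have key : ∀ a b : α, ∑ σ : Equiv.Perm α, f (σ a) (σ b) =
      if a = b then 0 else ∑ σ : Equiv.Perm α, f (σ i) (σ j) := by
    intro a b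
    split_ifs with hab
    · simp [hab, hf]
    · -- the permutation `τ` sends `i` to `a` and `j` to `b`
      let τ : Equiv.Perm α := Equiv.swap (Equiv.swap i a j) b * Equiv.swap i a
      have h1 : Equiv.swap i a j ≠ a := fun h => hij <| by
        rw [Equiv.swap_apply_eq_iff, Equiv.swap_apply_right] at h
        exact h.symm
      have hi : τ i = a := by
        simp only [τ, Equiv.Perm.mul_apply, Equiv.swap_apply_left]
        exact Equiv.swap_apply_of_ne_of_ne h1.symm hab
      have hj : τ j = b := by
        simp [τ, Equiv.Perm.mul_apply]
      rw [← Equiv.sum_comp (Equiv.mulRight τ) fun σ => f (σ i) (σ j)]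
      simp [Equiv.Perm.mul_apply, hi, hj]
  have hsum : ∀ σ : Equiv.Perm α, ∑ a, ∑ b, f (σ a) (σ b) = ∑ a, ∑ b, f a b := fun σ => by
    rw [← Equiv.sum_comp σ (fun a => ∑ b, f a b)]
    exact Finset.sum_congr rfl fun a _ => Equiv.sum_comp σ (fun b => f (σ a) b)
  have hrow : ∀ (a : α) (s : ℝ), ∑ b : α, (if a = b then 0 else s) = (Fintype.card α - 1) * s := by
    intro a s
    have : ∀ b : α, (if a = b then 0 else s) = s - if a = b then s else 0 := fun b => by
      split_ifs <;> simp
    simp [this, Finset.sum_sub_distrib, sub_mul]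
  calc (Fintype.card α : ℝ) * (Fintype.card α - 1) * ∑ σ : Equiv.Perm α, f (σ i) (σ j)
      = ∑ a, ∑ b, ∑ σ : Equiv.Perm α, f (σ a) (σ b) := by
        rw [Finset.sum_congr rfl fun a _ =>
          (Finset.sum_congr rfl fun b _ => key a b).trans (hrow a _)]
        simp [mul_assoc]
    _ = ∑ σ : Equiv.Perm α, ∑ a, ∑ b, f (σ a) (σ b) := by
        exact (Finset.sum_congr rfl fun a _ => Finset.sum_comm).trans Finset.sum_comm
    _ = _ := by simp [hsum]

/-- A permutation of the first `n` indices, extended to all of `ℕ` by the identity. -/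
def permOfFin {n : ℕ} (σ : Equiv.Perm (Fin n)) : Equiv.Perm ℕ :=
  σ.extendDomain Fin.equivSubtype

theorem permOfFin_coe {n : ℕ} (σ : Equiv.Perm (Fin n)) (i : Fin n) :
    permOfFin σ (i : ℕ) = (σ i : ℕ) :=
  Equiv.Perm.extendDomain_apply_image σ Fin.equivSubtype i

theorem permOfFin_lt_iff {n m : ℕ} (hnm : n ≤ m) (σ : Equiv.Perm (Fin n)) (i : ℕ) :
    permOfFin σ i < m ↔ i < m := by
  by_cases hi : i < n
  · have h1 := permOfFin_coe σ ⟨i, hi⟩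
    simp only at h1
    have h2 := (σ ⟨i, hi⟩).isLt
    constructor <;> intro <;> omega
  · rw [permOfFin, Equiv.Perm.extendDomain_apply_not_subtype σ Fin.equivSubtype hi]

/-! ### The collision frequency -/

/-- The indicator that the samples number `i` and `j` are different samples with the same value. -/
noncomputable def collision {β : Type*} [DecidableEq β] (x : ℕ → β) (i j : ℕ) : ℝ :=
  if i ≠ j ∧ x i = x j then 1 else 0

/-- The proportion of collisions among the pairs of the first `n` samples: the U-statistic that
estimates the collision probability. -/
noncomputable def collisionRate {β : Type*} [DecidableEq β] (x : ℕ → β) (n : ℕ) : ℝ :=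
  (∑ i ∈ Finset.range n, ∑ j ∈ Finset.range n, collision x i j) / (n * (n - 1))

/-- The proportion of collisions among the `b` disjoint pairs `(0, 1), (2, 3), …`. -/
noncomputable def pairedRate {β : Type*} [DecidableEq β] (b : ℕ) (x : ℕ → β) : ℝ :=
  (∑ l ∈ Finset.range b, collision x (2 * l) (2 * l + 1)) / b

section Collision

variable {β : Type*} [DecidableEq β]

theorem collision_self (x : ℕ → β) (i : ℕ) : collision x i i = 0 := by simp [collision]

theorem collision_comm (x : ℕ → β) (i j : ℕ) : collision x i j = collision x j i := by
  simp only [collision, ne_comm, eq_comm]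

theorem collision_comp_perm (x : ℕ → β) (e : Equiv.Perm ℕ) (i j : ℕ) :
    collision (fun t => x (e t)) i j = collision x (e i) (e j) := by
  simp [collision]

theorem collisionRate_comp_permOfFin (x : ℕ → β) {n m : ℕ} (hnm : n ≤ m)
    (σ : Equiv.Perm (Fin n)) :
    collisionRate (fun t => x (permOfFin σ t)) m = collisionRate x m := by
  have h : ∀ g : ℕ → ℝ, ∑ i ∈ Finset.range m, g (permOfFin σ i) = ∑ i ∈ Finset.range m, g i :=
    fun g => Finset.sum_equiv (permOfFin σ) (by simp [permOfFin_lt_iff hnm]) (by simp)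
  simp only [collisionRate, collision_comp_perm]
  rw [h fun i => ∑ j ∈ Finset.range m, collision x i (permOfFin σ j)]
  simp only [fun i => h fun j => collision x i j]

/-- The U-statistic is the average, over all orderings of the first `n` samples, of the paired
estimator, which is a mean of independent terms. -/
theorem collisionRate_eq_average (x : ℕ → β) {n b : ℕ} (hb : 0 < b) (hbn : 2 * b ≤ n) :
    collisionRate x n = ∑ σ : Equiv.Perm (Fin n),
      (Fintype.card (Equiv.Perm (Fin n)) : ℝ)⁻¹ • pairedRate b (fun t => x (permOfFin σ t)) := by
  have hP : (Fintype.card (Equiv.Perm (Fin n)) : ℝ) ≠ 0 := by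
    exact_mod_cast Fintype.card_ne_zero
  have hb0 : (b : ℝ) ≠ 0 := by exact_mod_cast hb.ne'
  have hn2 : (2 : ℝ) ≤ n := by exact_mod_cast (by omega : 2 ≤ n)
  have hn : (n : ℝ) * (n - 1) ≠ 0 := by
    refine mul_ne_zero ?_ ?_ <;> linarith
  have hS : ∑ i ∈ Finset.range n, ∑ j ∈ Finset.range n, collision x i j =
      ∑ i : Fin n, ∑ j : Fin n, collision x i j := by
    simp only [Finset.sum_range]
  have hpair : ∀ l ∈ Finset.range b, ∑ σ : Equiv.Perm (Fin n),
      collision x (permOfFin σ (2 * l)) (permOfFin σ (2 * l + 1)) =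
      Fintype.card (Equiv.Perm (Fin n)) * collisionRate x n := by
    intro l hl
    have hl' := Finset.mem_range.1 hl
    have h1 : 2 * l < n := by omega
    have h2 : 2 * l + 1 < n := by omega
    have h := sum_perm_apply_pair (fun a c : Fin n => collision x a c)
      (fun a => collision_self x a) (i := ⟨2 * l, h1⟩) (j := ⟨2 * l + 1, h2⟩) (by simp)
    simp only [← permOfFin_coe, Fintype.card_fin] at h
    rw [collisionRate, hS, mul_div_assoc', eq_div_iff hn, mul_comm, h]
  rw [← Finset.smul_sum]
  simp only [pairedRate, collision_comp_perm, ← Finset.sum_div]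
  rw [Finset.sum_comm, Finset.sum_congr rfl hpair]
  simp only [Finset.sum_const, Finset.card_range, nsmul_eq_mul, smul_eq_mul]
  field_simp

theorem pairedRate_mem_Icc (b : ℕ) (x : ℕ → β) : pairedRate b x ∈ Set.Icc (0 : ℝ) 1 := by
  have h0 : ∀ i j, 0 ≤ collision x i j := fun i j => by unfold collision; split_ifs <;> simp
  have h1 : ∀ i j, collision x i j ≤ 1 := fun i j => by unfold collision; split_ifs <;> simp
  refine ⟨div_nonneg (Finset.sum_nonneg fun _ _ => h0 _ _) (Nat.cast_nonneg _),
    div_le_one_of_le₀ ?_ (Nat.cast_nonneg _)⟩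
  simpa using Finset.sum_le_card_nsmul (Finset.range b) _ 1 fun l _ => h1 (2 * l) (2 * l + 1)

theorem sum_range_sum_range_eq_two_mul (f : ℕ → ℕ → ℝ) (h0 : ∀ i, f i i = 0)
    (hf : ∀ i j, f i j = f j i) (n : ℕ) :
    ∑ i ∈ Finset.range n, ∑ j ∈ Finset.range n, f i j =
      2 * ∑ i ∈ Finset.range n, ∑ j ∈ Finset.range i, f i j := by
  induction n with
  | zero => simp
  | succ n ih =>
    simp only [Finset.sum_range_succ, Finset.sum_add_distrib, ih, h0, mul_add,
      fun i => hf i n]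
    ring

/-- The tester's statistic is the U-statistic, centred at the null value. -/
theorem statistic_eq_collisionRate_sub {k : ℕ} (c₀ : ℝ) (x : ℕ → Fin k) {n : ℕ} (hn : 2 ≤ n) :
    SequentialTester.statistic c₀ x n = collisionRate x n - c₀ := by
  have hn2 : (2 : ℝ) ≤ n := by exact_mod_cast hn
  have hn1 : (n : ℝ) - 1 ≠ 0 := by linarith
  have hn0 : (n : ℝ) ≠ 0 := by linarith
  have hgauss : ∑ i ∈ Finset.range n, (i : ℝ) * c₀ = n * (n - 1) / 2 * c₀ := by
    rw [← Finset.sum_mul]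
    have h := congrArg (Nat.cast : ℕ → ℝ) (Finset.sum_range_id_mul_two n)
    rw [Nat.cast_mul, Nat.cast_mul, Nat.cast_sub (by omega), Nat.cast_sum] at h
    push_cast at h
    rw [← h]
    ring
  have hcoll : ∀ i ∈ Finset.range n, ∑ j ∈ Finset.range i, (if x i = x j then (1 : ℝ) else 0) =
      ∑ j ∈ Finset.range i, collision x i j := by
    refine fun i _ => Finset.sum_congr rfl fun j hj => ?_
    have : i ≠ j := (Finset.mem_range.1 hj).ne'
    simp [collision, this]
  simp only [SequentialTester.statistic, SequentialTester.increment, Finset.sum_sub_distrib,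
    hgauss]
  rw [Finset.sum_congr rfl hcoll, collisionRate,
    sum_range_sum_range_eq_two_mul _ (collision_self x) (collision_comm x)]
  field_simp

end Collision

/-! ### Exchangeability and independence of disjoint blocks -/

/-- Families of random variables drawn from disjoint blocks of an independent family are
independent. This is a converse of `ProbabilityTheory.iIndepFun_uncurry`. -/
theorem iIndepFun_curry {Ω ι : Type*} {κ : ι → Type*} {E : (i : ι) → κ i → Type*}
    {mΩ : MeasurableSpace Ω} {mE : ∀ i j, MeasurableSpace (E i j)} {μ : Measure Ω}
    {X : (i : ι) → (j : κ i) → Ω → E i j} (mX : ∀ i j, Measurable (X i j))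
    (h : iIndepFun (fun (p : (i : ι) × κ i) ω => X p.1 p.2 ω) μ) :
    iIndepFun (fun i ω => (X i · ω)) μ := by
  have := h.isProbabilityMeasure
  have : ∀ i j, IsProbabilityMeasure (μ.map (X i j)) :=
    fun i j => Measure.isProbabilityMeasure_map (mX i j).aemeasurable
  have hrow : ∀ i, iIndepFun (X i) μ := fun i =>
    h.precomp (g := fun j : κ i => (⟨i, j⟩ : (i : ι) × κ i)) sigma_mk_injective
  have hcurry : (MeasurableEquiv.piCurry E) ∘ (fun ω p => X p.1 p.2 ω) = fun ω i j => X i j ω := by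
    ext; simp [Sigma.curry]
  rw [iIndepFun_iff_map_fun_eq_infinitePi_map (by fun_prop), ← hcurry,
    ← Measure.map_map (by fun_prop) (by fun_prop), h.map_fun_eq_infinitePi_map (by fun_prop),
    Measure.infinitePi_map_piCurry (fun i j => μ.map (X i j))]
  congrm Measure.infinitePi fun i => ?_
  exact ((hrow i).map_fun_eq_infinitePi_map (mX i)).symm

section Sample

variable {Ω : Type*} [MeasurableSpace Ω] {μ : Measure Ω} {k : ℕ} {p : Fin k → ℝ}
  {X : ℕ → Ω → Fin k}

theorem IsIIDSample.map_eq [IsProbabilityMeasure μ] (hX : IsIIDSample p X μ) (i j : ℕ) :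
    μ.map (X i) = μ.map (X j) := by
  have := Measure.isProbabilityMeasure_map (μ := μ) (hX.measurable i).aemeasurable
  have := Measure.isProbabilityMeasure_map (μ := μ) (hX.measurable j).aemeasurable
  refine Measure.ext_of_measureReal_singleton fun a => ?_
  rw [map_measureReal_apply (hX.measurable i) (measurableSet_singleton a),
    map_measureReal_apply (hX.measurable j) (measurableSet_singleton a), hX.law, hX.law]

theorem IsIIDSample.measurable_sequence (hX : IsIIDSample p X μ) :
    Measurable (fun ω i => X i ω) :=
  measurable_pi_iff.2 hX.measurable

/-- The law of an i.i.d. sequence is exchangeable. -/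
theorem IsIIDSample.measurePreserving_comp_perm [IsProbabilityMeasure μ] (hX : IsIIDSample p X μ)
    (e : Equiv.Perm ℕ) :
    MeasurePreserving (fun (x : ℕ → Fin k) t => x (e t))
      (μ.map fun ω i => X i ω) (μ.map fun ω i => X i ω) := by
  have hm : Measurable fun (x : ℕ → Fin k) t => x (e t) := by fun_prop
  refine ⟨hm, ?_⟩
  rw [Measure.map_map hm hX.measurable_sequence]
  have h1 := (hX.indep.precomp e.injective).map_fun_eq_infinitePi_map fun i => hX.measurable (e i)
  have h2 := hX.indep.map_fun_eq_infinitePi_map hX.measurable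
  rw [h2, Function.comp_def, h1]
  congrm Measure.infinitePi fun i => ?_
  exact hX.map_eq _ _

theorem measurable_collision (i j : ℕ) : Measurable fun x : ℕ → Fin k => collision x i j := by
  unfold collision
  refine Measurable.ite (measurableSet_setOfPred.2 (measurable_const.and ?_)) measurable_const
    measurable_const
  exact measurableSet_setOfPred.1
    (measurableSet_eq_fun (measurable_pi_apply i) (measurable_pi_apply j))

@[fun_prop]
theorem measurable_collisionRate (n : ℕ) :
    Measurable fun x : ℕ → Fin k => collisionRate x n :=
  (Finset.measurable_sum _ fun i _ => Finset.measurable_sum _ fun j _ =>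
    measurable_collision i j).div_const _

@[fun_prop]
theorem measurable_pairedRate (b : ℕ) : Measurable fun x : ℕ → Fin k => pairedRate b x :=
  (Finset.measurable_sum _ fun _ _ => measurable_collision _ _).div_const _

theorem IsIIDSample.integral_collision [IsProbabilityMeasure μ] (hX : IsIIDSample p X μ)
    {i j : ℕ} (hij : i ≠ j) :
    ∫ ω, collision (fun t => X t ω) i j ∂μ = collisionProb p := by
  have hs : ∀ a, MeasurableSet (X i ⁻¹' {a} ∩ X j ⁻¹' {a}) := fun a =>
    (hX.measurable i (measurableSet_singleton a)).inter
      (hX.measurable j (measurableSet_singleton a))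
  have h : ∀ ω, collision (fun t => X t ω) i j =
      ∑ a, (X i ⁻¹' {a} ∩ X j ⁻¹' {a}).indicator (fun _ => (1 : ℝ)) ω := by
    intro ω
    rw [Finset.sum_eq_single (X i ω)]
    · by_cases h : X i ω = X j ω
      · simp [collision, hij, h]
      · rw [Set.indicator_of_notMem fun hmem => h hmem.2.symm]
        simp [collision, h]
    · intro a _ ha
      exact Set.indicator_of_notMem (fun hmem => ha hmem.1.symm) _
    · simp
  simp only [h]
  rw [integral_finsetSum _ fun a _ => (integrable_const (1 : ℝ)).indicator (hs a)]
  refine Finset.sum_congr rfl fun a _ => ?_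
  rw [integral_indicator_const _ (hs a), smul_eq_mul, mul_one, sq, Measure.real,
    (hX.indep.indepFun hij).measure_inter_preimage_eq_mul _ _ (measurableSet_singleton a)
      (measurableSet_singleton a), ENNReal.toReal_mul]
  exact congrArg₂ _ (hX.law i a) (hX.law j a)

/-! ### Exponential moments and the maximal inequality -/

/-- Hoeffding's bound for the exponential moments of the mean of `b` independent indicators. -/
theorem IsIIDSample.integral_exp_pairedRate_le [IsProbabilityMeasure μ] (hX : IsIIDSample p X μ)
    {b : ℕ} (hb : 0 < b) (s : ℝ) :
    ∫ ω, Real.exp (s * (pairedRate b (fun t => X t ω) - collisionProb p)) ∂μ ≤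
      Real.exp (s ^ 2 / (8 * b)) := by
  have hb0 : (b : ℝ) ≠ 0 := by exact_mod_cast hb.ne'
  let Z : ℕ → Ω → ℝ := fun l ω => collision (fun t => X t ω) (2 * l) (2 * l + 1)
  have hZm : ∀ l, Measurable (Z l) := fun l =>
    (measurable_collision (2 * l) (2 * l + 1)).comp hX.measurable_sequence
  have hZint : ∀ l, ∫ ω, Z l ω ∂μ = collisionProb p := fun l => hX.integral_collision (by simp)
  have hinj : Function.Injective fun q : (_ : ℕ) × Fin 2 => 2 * q.1 + (q.2 : ℕ) := by
    rintro ⟨a, c⟩ ⟨a', c'⟩ h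
    have h1 := c.isLt
    have h2 := c'.isLt
    simp only at h
    obtain rfl : a = a' := by omega
    obtain rfl : c = c' := by omega
    rfl
  have hblocks : iIndepFun (fun (l : ℕ) ω => fun c : Fin 2 => X (2 * l + c) ω) μ :=
    iIndepFun_curry (κ := fun _ : ℕ => Fin 2) (E := fun _ _ => Fin k)
      (X := fun l c => X (2 * l + c)) (fun l c => hX.measurable _) (hX.indep.precomp hinj)
  have hZ : iIndepFun (fun l ω => Z l ω - collisionProb p) μ := by
    have := hblocks.comp (fun _ y => (if y 0 = y 1 then (1 : ℝ) else 0) - collisionProb p)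
      fun _ => measurable_of_countable _
    convert this using 3 with l ω
    simp [Z, collision]
  have hsub : ∀ l ∈ Finset.range b,
      HasSubgaussianMGF (fun ω => Z l ω - collisionProb p) ((‖(1 : ℝ) - 0‖₊ / 2) ^ 2) μ := by
    intro l _
    rw [← hZint l]
    refine hasSubgaussianMGF_of_mem_Icc (hZm l).aemeasurable (ae_of_all _ fun ω => ?_)
    simp only [Z, collision]
    split_ifs <;> simp
  have hmgf := (HasSubgaussianMGF.sum_of_iIndepFun hZ hsub).mgf_le (s / b)
  have hL : ∀ ω, s * (pairedRate b (fun t => X t ω) - collisionProb p) =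
      s / b * ∑ l ∈ Finset.range b, (Z l ω - collisionProb p) := by
    intro ω
    simp only [pairedRate, Finset.sum_sub_distrib, Z, Finset.sum_const, Finset.card_range,
      nsmul_eq_mul]
    field_simp
  simp only [hL]
  refine hmgf.trans (le_of_eq ?_)
  congr 1
  simp
  field_simp
  ring

/-- A maximal inequality of Doob type for the U-statistic, which is a reversed martingale. It holds
because the event that `n` is the last time in the window at which the level `a` is reached does
not depend on the order of the first `n` samples: on that event, the exponential of the
U-statistic is dominated in mean by the exponential of the paired estimator. -/
theorem IsIIDSample.maximal_inequality [IsProbabilityMeasure μ] (hX : IsIIDSample p X μ)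
    {b : ℕ} (hb : 0 < b) (M : ℕ) (s c a : ℝ) :
    a * μ.real {ω | ∃ n, 2 * b ≤ n ∧ n ≤ M ∧
        a ≤ Real.exp (s * (collisionRate (fun i => X i ω) n - c))} ≤
      ∫ ω, Real.exp (s * (pairedRate b (fun i => X i ω) - c)) ∂μ := by
  set P := μ.map fun ω i => X i ω with hP
  have : IsProbabilityMeasure P :=
    Measure.isProbabilityMeasure_map hX.measurable_sequence.aemeasurable
  let Y : ℕ → (ℕ → Fin k) → ℝ := fun n x => Real.exp (s * (collisionRate x n - c))
  let G : (ℕ → Fin k) → ℝ := fun x => Real.exp (s * (pairedRate b x - c))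
  have hYm : ∀ n, Measurable (Y n) := fun n => by fun_prop
  have hGm : Measurable G := by fun_prop
  have hGbound : ∀ x, G x ≤ Real.exp (|s| * (1 + |c|)) := by
    intro x
    obtain ⟨h0, h1⟩ := pairedRate_mem_Icc b x
    refine Real.exp_le_exp.2 ((le_abs_self _).trans ?_)
    rw [abs_mul]
    gcongr
    exact (abs_sub _ _).trans (by rw [abs_of_nonneg h0]; gcongr)
  have hGi : Integrable G P := by
    refine Integrable.of_bound hGm.aestronglyMeasurable (Real.exp (|s| * (1 + |c|)))
      (ae_of_all _ fun x => ?_)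
    rw [Real.norm_of_nonneg (Real.exp_nonneg _)]
    exact hGbound x
  have hGσ : ∀ e : Equiv.Perm ℕ, Integrable (fun x => G fun t => x (e t)) P := fun e =>
    (hX.measurePreserving_comp_perm e).integrable_comp_of_integrable hGi
  -- `A n` is the event that `n` is the last time up to `M` at which the level `a` is reached
  let A : ℕ → Set (ℕ → Fin k) := fun n => {x | a ≤ Y n x ∧ ∀ j, n < j → j ≤ M → Y j x < a}
  have hAm : ∀ n, MeasurableSet (A n) := fun n => by
    refine measurableSet_setOfPred.2 ((measurableSet_setOfPred.1
      (measurableSet_le measurable_const (hYm n))).and (Measurable.forall fun j =>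
        measurable_const.imp (measurable_const.imp (measurableSet_setOfPred.1
          (measurableSet_lt (hYm j) measurable_const)))))
  have hAdisj : Set.Pairwise (↑(Finset.Icc (2 * b) M) : Set ℕ) (Function.onFun Disjoint A) := by
    have hlt : ∀ i j, i < j → j ≤ M → Disjoint (A i) (A j) := fun i j hij hj =>
      Set.disjoint_left.2 fun x hi hj' => (hi.2 j hij hj).not_ge hj'.1
    intro i hi j hj hij
    rw [Finset.mem_coe, Finset.mem_Icc] at hi hj
    rcases hij.lt_or_gt with h | h
    · exact hlt i j h hj.2
    · exact (hlt j i h hi.2).symm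
  have hAperm : ∀ n (σ : Equiv.Perm (Fin n)) x, (fun t => x (permOfFin σ t)) ∈ A n ↔ x ∈ A n := by
    intro n σ x
    have h : ∀ j, n ≤ j → Y j (fun t => x (permOfFin σ t)) = Y j x := fun j hj => by
      simp only [Y, collisionRate_comp_permOfFin x hj σ]
    simp only [A, Set.mem_ofPred_eq, h n le_rfl]
    refine and_congr_right fun _ => forall₂_congr fun j hj => ?_
    rw [h j hj.le]
  have hunion : {ω | ∃ n, 2 * b ≤ n ∧ n ≤ M ∧
        a ≤ Real.exp (s * (collisionRate (fun i => X i ω) n - c))} ⊆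
      (fun ω i => X i ω) ⁻¹' ⋃ n ∈ Finset.Icc (2 * b) M, A n := by
    rintro ω ⟨n, hbn, hnM, hn⟩
    classical
    let S := (Finset.Icc (2 * b) M).filter fun m => a ≤ Y m fun i => X i ω
    have hS : n ∈ S := Finset.mem_filter.2 ⟨Finset.mem_Icc.2 ⟨hbn, hnM⟩, hn⟩
    have hmax := Finset.mem_filter.1 (S.max'_mem ⟨n, hS⟩)
    refine Set.mem_biUnion hmax.1 ⟨hmax.2, fun j hj hjM => ?_⟩
    by_contra! hcon
    have hjS : j ∈ S := Finset.mem_filter.2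
      ⟨Finset.mem_Icc.2 ⟨(Finset.mem_Icc.1 hmax.1).1.trans hj.le, hjM⟩, hcon⟩
    exact (S.le_max' j hjS).not_gt hj
  have hstep : ∀ n ∈ Finset.Icc (2 * b) M, a * P.real (A n) ≤ ∫ x in A n, G x ∂P := by
    intro n hn
    have hbn := (Finset.mem_Icc.1 hn).1
    have hcard : (Fintype.card (Equiv.Perm (Fin n)) : ℝ) ≠ 0 := by
      exact_mod_cast Fintype.card_ne_zero
    let w : ℝ := (Fintype.card (Equiv.Perm (Fin n)) : ℝ)⁻¹
    have hw : ∑ _σ : Equiv.Perm (Fin n), w = 1 := by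
      simp [w, hcard]
    -- Jensen's inequality
    have hjensen : ∀ x, Y n x ≤ ∑ σ : Equiv.Perm (Fin n), w * G fun t => x (permOfFin σ t) := by
      intro x
      have h := convexOn_exp.map_sum_le (t := Finset.univ) (w := fun _ : Equiv.Perm (Fin n) => w)
        (p := fun σ => s * (pairedRate b (fun t => x (permOfFin σ t)) - c))
        (fun _ _ => by positivity) hw fun _ _ => Set.mem_univ _
      refine le_of_eq_of_le ?_ h
      simp only [Y]
      rw [collisionRate_eq_average x hb hbn]
      congr 1
      simp only [smul_eq_mul, mul_sub, Finset.sum_sub_distrib, ← Finset.sum_mul]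
      change _ = _ - (∑ _σ : Equiv.Perm (Fin n), w) * _
      rw [hw, Finset.mul_sum, one_mul]
      congr 1
      exact Finset.sum_congr rfl fun σ _ => by ring
    have hint : ∀ σ : Equiv.Perm (Fin n),
        ∫ x in A n, G (fun t => x (permOfFin σ t)) ∂P = ∫ x in A n, G x ∂P := by
      intro σ
      have hmp := hX.measurePreserving_comp_perm (permOfFin σ)
      rw [← integral_indicator (hAm n), ← integral_indicator (hAm n)]
      conv_rhs => rw [hP, ← hmp.map_eq]
      rw [integral_map hmp.measurable.aemeasurable
        (hGm.indicator (hAm n)).aestronglyMeasurable]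
      refine integral_congr_ae (ae_of_all _ fun x => ?_)
      by_cases hx : x ∈ A n
      · simp only [Set.indicator_of_mem hx, Set.indicator_of_mem ((hAperm n σ x).2 hx)]
      · simp only [Set.indicator_of_notMem hx,
          Set.indicator_of_notMem (mt (hAperm n σ x).1 hx)]
    have hsumi : Integrable (fun x => ∑ σ : Equiv.Perm (Fin n),
        w * G fun t => x (permOfFin σ t)) P :=
      integrable_finsetSum _ fun σ _ => (hGσ _).const_mul w
    calc a * P.real (A n)
        ≤ ∫ x in A n, ∑ σ : Equiv.Perm (Fin n), w * G (fun t => x (permOfFin σ t)) ∂P :=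
          setIntegral_ge_of_const_le_real (hAm n) (measure_ne_top _ _)
            (fun x hx => hx.1.trans (hjensen x)) hsumi.integrableOn
      _ = ∑ σ : Equiv.Perm (Fin n), w * ∫ x in A n, G x ∂P := by
          rw [integral_finsetSum _ fun σ _ => ((hGσ _).const_mul w).integrableOn]
          exact Finset.sum_congr rfl fun σ _ => by rw [integral_const_mul, hint]
      _ = ∫ x in A n, G x ∂P := by rw [← Finset.sum_mul, hw, one_mul]
  have hGnn : 0 ≤ ∫ x, G x ∂P := integral_nonneg fun x => Real.exp_nonneg _
  have hGX : ∫ x, G x ∂P = ∫ ω, G (fun i => X i ω) ∂μ :=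
    integral_map hX.measurable_sequence.aemeasurable hGm.aestronglyMeasurable
  rcases le_or_gt a 0 with ha | ha
  · exact (mul_nonpos_of_nonpos_of_nonneg ha measureReal_nonneg).trans (hGX ▸ hGnn)
  calc a * μ.real _
      ≤ a * P.real (⋃ n ∈ Finset.Icc (2 * b) M, A n) := by
        rw [hP, map_measureReal_apply hX.measurable_sequence
          (Finset.measurableSet_biUnion _ fun n _ => hAm n)]
        exact mul_le_mul_of_nonneg_left (measureReal_mono hunion) ha.le
    _ ≤ a * ∑ n ∈ Finset.Icc (2 * b) M, P.real (A n) :=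
        mul_le_mul_of_nonneg_left (measureReal_biUnion_finset_le _ _) ha.le
    _ ≤ ∑ n ∈ Finset.Icc (2 * b) M, ∫ x in A n, G x ∂P := by
        rw [Finset.mul_sum]
        exact Finset.sum_le_sum hstep
    _ = ∫ x in ⋃ n ∈ Finset.Icc (2 * b) M, A n, G x ∂P :=
        (integral_biUnion_finset _ (fun n _ => hAm n) hAdisj fun n _ => hGi.integrableOn).symm
    _ ≤ ∫ x, G x ∂P := setIntegral_le_integral hGi (ae_of_all _ fun x => Real.exp_nonneg _)
    _ = _ := hGX

/-- A two-sided Hoeffding inequality for the U-statistic, uniform over a window of sample sizes. -/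
theorem IsIIDSample.measure_exists_collisionRate_deviation_le [IsProbabilityMeasure μ]
    (hX : IsIIDSample p X μ) {b : ℕ} (hb : 0 < b) (M : ℕ) {u : ℝ} (hu : 0 ≤ u) :
    μ.real {ω | ∃ n, 2 * b ≤ n ∧ n ≤ M ∧
        u ≤ |collisionRate (fun i => X i ω) n - collisionProb p|} ≤
      2 * Real.exp (-(2 * b * u ^ 2)) := by
  have hb0 : (0 : ℝ) < b := by exact_mod_cast hb
  have hside : ∀ s : ℝ, s ^ 2 = (4 * b * u) ^ 2 →
      μ.real {ω | ∃ n, 2 * b ≤ n ∧ n ≤ M ∧ Real.exp (4 * b * u ^ 2) ≤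
        Real.exp (s * (collisionRate (fun i => X i ω) n - collisionProb p))} ≤
        Real.exp (-(2 * b * u ^ 2)) := by
    intro s hs
    have h := (hX.maximal_inequality hb M s (collisionProb p) (Real.exp (4 * b * u ^ 2))).trans
      (hX.integral_exp_pairedRate_le hb s)
    rw [← le_div_iff₀' (Real.exp_pos _), ← Real.exp_sub, hs] at h
    refine h.trans (le_of_eq ?_)
    congr 1
    field_simp
    ring
  refine (measureReal_mono (s₂ := {ω | ∃ n, 2 * b ≤ n ∧ n ≤ M ∧ Real.exp (4 * b * u ^ 2) ≤
      Real.exp (4 * b * u * (collisionRate (fun i => X i ω) n - collisionProb p))} ∪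
    {ω | ∃ n, 2 * b ≤ n ∧ n ≤ M ∧ Real.exp (4 * b * u ^ 2) ≤
      Real.exp (-(4 * b * u) * (collisionRate (fun i => X i ω) n - collisionProb p))}) ?_).trans
    ((measureReal_union_le _ _).trans ?_)
  · rintro ω ⟨n, h1, h2, h3⟩
    have h4 : 0 ≤ 4 * (b : ℝ) * u := by positivity
    rcases le_abs.1 h3 with h | h
    · exact Or.inl ⟨n, h1, h2, Real.exp_le_exp.2 (by nlinarith)⟩
    · exact Or.inr ⟨n, h1, h2, Real.exp_le_exp.2 (by nlinarith)⟩
  · rw [two_mul (Real.exp _)]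
    exact add_le_add (hside _ rfl) (hside _ (neg_sq _))

end Sample

/-! ### The time-uniform confidence bound -/

section Threshold

variable {δ : ℝ}

theorem le_log_const_div (hδ₀ : 0 < δ) (hδ₁ : δ ≤ 1) : 2.7 ≤ Real.log (20.8 / δ) := by
  have h2 := Real.log_two_gt_d9
  have h16 : Real.log 16 = 4 * Real.log 2 := by
    rw [show (16 : ℝ) = 2 ^ 4 by norm_num, Real.log_pow]; norm_num
  have h : Real.log 16 ≤ Real.log (20.8 / δ) := by
    refine Real.log_le_log (by norm_num) ?_
    rw [le_div_iff₀ hδ₀]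
    linarith
  linarith

theorem log_succ_mul_log_two_add_nonneg (hδ₀ : 0 < δ) (hδ₁ : δ ≤ 1) (j : ℕ) :
    0 ≤ Real.log ((j + 1) * Real.log 2) + 0.72 * Real.log (20.8 / δ) := by
  have h2 := Real.log_two_gt_d9
  have hj : (0 : ℝ) ≤ j := Nat.cast_nonneg j
  have h1 := le_log_const_div hδ₀ hδ₁
  have h3 : Real.log (1 / 2) ≤ Real.log ((j + 1) * Real.log 2) :=
    Real.log_le_log (by norm_num) (by nlinarith)
  have h4 : Real.log (1 / 2) = -Real.log 2 := by rw [one_div, Real.log_inv]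
  have h5 := Real.log_two_lt_d9
  linarith

/-- The value that bounds the rejection threshold from below on the `j`-th dyadic block
`[2 ^ (j + 1), 2 ^ (j + 2)]` of sample sizes. -/
noncomputable def blockThreshold (δ : ℝ) (j : ℕ) : ℝ :=
  3.2 * √((Real.log ((j + 1) * Real.log 2) + 0.72 * Real.log (20.8 / δ)) / (4 * 2 ^ j))

theorem blockThreshold_le_threshold (hδ₀ : 0 < δ) (hδ₁ : δ ≤ 1) {j n : ℕ}
    (hjn : 2 * 2 ^ j ≤ n) (hnj : n ≤ 4 * 2 ^ j) :
    blockThreshold δ j ≤ SequentialTester.threshold δ n := by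
  have h1 : (2 : ℝ) * 2 ^ j ≤ n := by exact_mod_cast hjn
  have h2 : (n : ℝ) ≤ 4 * 2 ^ j := by exact_mod_cast hnj
  have hn : (0 : ℝ) < n := lt_of_lt_of_le (by positivity) h1
  have hq := log_succ_mul_log_two_add_nonneg hδ₀ hδ₁ j
  have hlog : (j + 1) * Real.log 2 ≤ Real.log n := by
    have : ((j : ℝ) + 1) * Real.log 2 = Real.log (2 * 2 ^ j) := by
      rw [← pow_succ', Real.log_pow]; push_cast; ring
    rw [this]
    exact Real.log_le_log (by positivity) h1
  have hlog2 := Real.log_pos one_lt_two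
  have hloglog : Real.log ((j + 1) * Real.log 2) ≤ Real.log (Real.log n) :=
    Real.log_le_log (by positivity) hlog
  unfold blockThreshold SequentialTester.threshold
  gcongr
  linarith

/-- The failure probabilities on the dyadic blocks decay like `1 / (j + 1) ^ 2`: the iterated
logarithm in the threshold contributes a power of the block number. -/
theorem two_mul_exp_blockThreshold_le (hδ₀ : 0 < δ) (hδ₁ : δ ≤ 1) (j : ℕ) :
    2 * Real.exp (-(2 * ((2 ^ j : ℕ) : ℝ) * blockThreshold δ j ^ 2)) ≤
      δ / 2 * (1 / ((j + 1 : ℕ) : ℝ) ^ 2) := by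
  have hq := log_succ_mul_log_two_add_nonneg hδ₀ hδ₁ j
  have hL := le_log_const_div hδ₀ hδ₁
  have h2 := Real.log_two_gt_d9
  have hlog2 := Real.log_pos one_lt_two
  set q := Real.log ((j + 1) * Real.log 2) + 0.72 * Real.log (20.8 / δ) with hqdef
  have hexp : -(2 * ((2 ^ j : ℕ) : ℝ) * blockThreshold δ j ^ 2) = -(5.12 * q) := by
    rw [blockThreshold, mul_pow, Real.sq_sqrt (div_nonneg hq (by positivity))]
    push_cast
    field_simp
    ring
  have hj : (0 : ℝ) < (j + 1) * Real.log 2 := by positivity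
  have hle : Real.exp (-(5.12 * q)) ≤
      (((j + 1) * Real.log 2) ^ 2)⁻¹ * (δ / 20.8) := by
    calc Real.exp (-(5.12 * q))
        ≤ Real.exp (-(2 * Real.log ((j + 1) * Real.log 2)) + -Real.log (20.8 / δ)) := by
          apply Real.exp_le_exp.2
          linarith
      _ = _ := by
          rw [Real.exp_add, Real.exp_neg, Real.exp_neg, Real.exp_log (by positivity), two_mul,
            Real.exp_add, Real.exp_log hj, inv_div, sq]
  rw [hexp]
  push_cast
  have hlsq : 0.48 ≤ Real.log 2 ^ 2 := by nlinarith
  calc 2 * Real.exp (-(5.12 * q)) ≤ 2 * ((((j + 1) * Real.log 2) ^ 2)⁻¹ * (δ / 20.8)) := by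
        gcongr
    _ = (2 / 20.8 * (Real.log 2 ^ 2)⁻¹) * (δ * (1 / ((j : ℝ) + 1) ^ 2)) := by
        rw [mul_pow]; field_simp
    _ ≤ 1 / 2 * (δ * (1 / ((j : ℝ) + 1) ^ 2)) := by
        gcongr
        calc 2 / 20.8 * (Real.log 2 ^ 2)⁻¹ ≤ 2 / 20.8 * (0.48 : ℝ)⁻¹ := by gcongr
          _ ≤ 1 / 2 := by norm_num
    _ = _ := by ring

/-- The rejection threshold is, at every sample size simultaneously, a confidence bound for the
error of the U-statistic. -/
theorem IsIIDSample.one_sub_le_measure_forall_abs_sub_le_threshold {Ω : Type*} [MeasurableSpace Ω]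
    {μ : Measure Ω} [IsProbabilityMeasure μ] {k : ℕ} {p : Fin k → ℝ} {X : ℕ → Ω → Fin k}
    (hX : IsIIDSample p X μ) (hδ₀ : 0 < δ) (hδ₁ : δ ≤ 1) :
    1 - δ ≤ μ.real {ω | ∀ n, 2 ≤ n → |collisionRate (fun i => X i ω) n - collisionProb p| ≤
      SequentialTester.threshold δ n} := by
  set S := {ω | ∀ n, 2 ≤ n → |collisionRate (fun i => X i ω) n - collisionProb p| ≤
      SequentialTester.threshold δ n} with hS
  let B : ℕ → Set Ω := fun j => {ω | ∃ n, 2 * 2 ^ j ≤ n ∧ n ≤ 4 * 2 ^ j ∧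
    blockThreshold δ j ≤ |collisionRate (fun i => X i ω) n - collisionProb p|}
  have hB : ∀ j, μ (B j) ≤ ENNReal.ofReal (δ / 2 * (1 / ((j + 1 : ℕ) : ℝ) ^ 2)) := by
    intro j
    rw [← ofReal_measureReal]
    refine ENNReal.ofReal_le_ofReal ?_
    have hu : 0 ≤ blockThreshold δ j := by unfold blockThreshold; positivity
    exact (hX.measure_exists_collisionRate_deviation_le (b := 2 ^ j) (by positivity)
      (4 * 2 ^ j) hu).trans (two_mul_exp_blockThreshold_le hδ₀ hδ₁ j)
  have hsum : HasSum (fun j : ℕ => δ / 2 * (1 / ((j + 1 : ℕ) : ℝ) ^ 2))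
      (δ / 2 * (Real.pi ^ 2 / 6)) := by
    have h := (hasSum_nat_add_iff' 1).2 hasSum_zeta_two
    simpa using h.mul_left (δ / 2)
  have hunion : μ (⋃ j, B j) ≤ ENNReal.ofReal δ := by
    refine (measure_iUnion_le B).trans ((ENNReal.tsum_le_tsum hB).trans ?_)
    rw [← ENNReal.ofReal_tsum_of_nonneg (fun j => by positivity) hsum.summable, hsum.tsum_eq]
    refine ENNReal.ofReal_le_ofReal ?_
    have hpi : Real.pi ^ 2 ≤ 12 := by nlinarith [Real.pi_lt_d2, Real.pi_pos]
    nlinarith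
  have hcover : Set.univ ⊆ S ∪ ⋃ j, B j := by
    intro ω _
    by_cases hω : ω ∈ S
    · exact Or.inl hω
    · simp only [hS, Set.mem_ofPred_eq, not_forall, not_le] at hω
      obtain ⟨n, hn, hlt⟩ := hω
      have hlog : 1 ≤ Nat.log 2 n := Nat.log_pos one_lt_two hn
      obtain ⟨j, hj⟩ := Nat.exists_eq_add_of_le' hlog
      have h1 : 2 ^ (j + 1) ≤ n := hj ▸ Nat.pow_log_le_self 2 (by omega)
      have h2 : n < 2 ^ (j + 1 + 1) := hj ▸ Nat.lt_pow_succ_log_self one_lt_two n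
      have h3 : 2 * 2 ^ j ≤ n := by rw [pow_succ] at h1; omega
      have h4 : n ≤ 4 * 2 ^ j := by rw [pow_succ, pow_succ] at h2; omega
      exact Or.inr (Set.mem_iUnion.2 ⟨j, n, h3, h4,
        (blockThreshold_le_threshold hδ₀ hδ₁ h3 h4).trans hlt.le⟩)
  have h1 : 1 ≤ μ.real S + μ.real (⋃ j, B j) := by
    rw [← probReal_univ (μ := μ)]
    exact (measureReal_mono hcover).trans (measureReal_union_le _ _)
  have h2 : μ.real (⋃ j, B j) ≤ δ := ENNReal.toReal_le_of_le_ofReal hδ₀.le hunion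
  linarith

/-! ### The sample size at which the threshold becomes small -/

/-- The threshold drops below `ε / 2` within the announced number of samples. -/
theorem exists_two_mul_threshold_lt (hδ₀ : 0 < δ) {ε : ℝ} (hε₀ : 0 < ε) (hε₁ : ε ≤ 1) :
    ∃ n : ℕ, 2 ≤ n ∧ 2 * SequentialTester.threshold δ n < ε ∧
      (n : ℝ) ≤ 1024 * (1 / ε ^ 2 * max 1 (Real.log (Real.log (1 / ε))) *
        max 1 (Real.log (1 / δ))) := by
  set B := max 1 (Real.log (Real.log (1 / ε)))
  set D := max 1 (Real.log (1 / δ))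
  have hB : 1 ≤ B := le_max_left _ _
  have hD : 1 ≤ D := le_max_left _ _
  have hBD : 1 ≤ B * D := one_le_mul_of_one_le_of_one_le hB hD
  have hε : 1 ≤ 1 / ε := (one_le_div hε₀).2 hε₁
  have hε2 : 1 ≤ 1 / ε ^ 2 := by rw [← one_div_pow]; exact one_le_pow₀ hε
  set x := 1 / ε ^ 2 * B * D with hx
  have hx1 : 1 ≤ x := by
    rw [hx, mul_assoc]
    exact one_le_mul_of_one_le_of_one_le hε2 hBD
  have hceil : 1023 * x ≤ (⌈1023 * x⌉₊ : ℝ) := Nat.le_ceil _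
  have hceil' : (⌈1023 * x⌉₊ : ℝ) ≤ 1024 * x := by
    have := Nat.ceil_lt_add_one (show 0 ≤ 1023 * x by positivity)
    linarith
  set n := ⌈1023 * x⌉₊
  have hn : (1023 : ℝ) ≤ n := by linarith
  refine ⟨n, by exact_mod_cast (show (2 : ℝ) ≤ n by linarith), ?_, hceil'⟩
  have hl2 := Real.log_two_lt_d9
  -- this also covers `ε` so close to `1` that the iterated logarithm is negative or junk
  have hlogε : Real.log (1 / ε) ≤ Real.exp B := by
    rcases (Real.log_nonneg hε).eq_or_lt with h | h
    · rw [← h]; exact (Real.exp_pos _).le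
    · calc Real.log (1 / ε) = Real.exp (Real.log (Real.log (1 / ε))) := (Real.exp_log h).symm
        _ ≤ Real.exp B := Real.exp_le_exp.2 (le_max_right _ _)
  have hlogx : Real.log x ≤ B + D + 2 * Real.exp B := by
    have hB' := Real.log_le_self (show 0 ≤ B by positivity)
    have hD' := Real.log_le_self (show 0 ≤ D by positivity)
    rw [hx, Real.log_mul (by positivity) (by positivity),
      Real.log_mul (by positivity) (by positivity), ← one_div_pow, Real.log_pow]
    push_cast
    linarith
  have hlogn : Real.log n ≤ 11 * (Real.exp B * D) := by
    have h1 : Real.log n ≤ Real.log 1024 + Real.log x := by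
      rw [← Real.log_mul (by norm_num) (by positivity)]
      exact Real.log_le_log (by linarith) hceil'
    have h2 : Real.log 1024 = 10 * Real.log 2 := by
      rw [show (1024 : ℝ) = 2 ^ 10 by norm_num, Real.log_pow]; norm_num
    have hBexp : B ≤ Real.exp B := by linarith [Real.add_one_le_exp B]
    have h3 : Real.exp B ≤ Real.exp B * D := le_mul_of_one_le_right (Real.exp_pos _).le hD
    have h4 : D ≤ Real.exp B * D := le_mul_of_one_le_left (by positivity) (hB.trans hBexp)
    linarith
  have hloglogn : Real.log (Real.log n) ≤ 12 * (B * D) := by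
    have h1 : Real.log (Real.log n) ≤ Real.log (11 * (Real.exp B * D)) :=
      Real.log_le_log (Real.log_pos (by linarith)) hlogn
    rw [Real.log_mul (by norm_num) (by positivity), Real.log_mul (by positivity) (by positivity),
      Real.log_exp] at h1
    have h2 := Real.log_le_sub_one_of_pos (show (0 : ℝ) < 11 by norm_num)
    have h3 := Real.log_le_self (show 0 ≤ D by positivity)
    nlinarith
  have hlogδ : Real.log (20.8 / δ) ≤ 4.5 * (B * D) := by
    have h1 : Real.log (20.8 / δ) = Real.log 20.8 + Real.log (1 / δ) := by
      rw [← Real.log_mul (by norm_num) (by positivity)]; ring_nf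
    have h2 : Real.log 20.8 ≤ Real.log 32 := Real.log_le_log (by norm_num) (by norm_num)
    have h3 : Real.log 32 = 5 * Real.log 2 := by
      rw [show (32 : ℝ) = 2 ^ 5 by norm_num, Real.log_pow]; norm_num
    have h4 : Real.log (1 / δ) ≤ D := le_max_right _ _
    have h5 : D ≤ B * D := le_mul_of_one_le_left (by positivity) hB
    linarith
  have hfrac : (Real.log (Real.log n) + 0.72 * Real.log (20.8 / δ)) / n < (5 / 32 * ε) ^ 2 := by
    rw [div_lt_iff₀ (by linarith)]
    have hnBD : 1023 * (B * D) ≤ ε ^ 2 * n := by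
      calc 1023 * (B * D) = ε ^ 2 * (1023 * x) := by rw [hx]; field_simp
        _ ≤ ε ^ 2 * n := by gcongr
    calc Real.log (Real.log n) + 0.72 * Real.log (20.8 / δ) <
        (5 / 32) ^ 2 * (1023 * (B * D)) := by
          linarith
      _ ≤ (5 / 32) ^ 2 * (ε ^ 2 * n) := by gcongr
      _ = (5 / 32 * ε) ^ 2 * n := by ring
  have := (Real.sqrt_lt' (by positivity)).2 hfrac
  unfold SequentialTester.threshold
  linarith

end Threshold

/-! ### The sequential tester -/

namespace SequentialTester

variable {k : ℕ} {c₀ δ : ℝ} {x : ℕ → Fin k}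

theorem rejectionTime_eq_top_iff : rejectionTime c₀ δ x = ⊤ ↔ ∀ n, ¬ RejectCond c₀ δ x n := by
  simp [rejectionTime]

theorem exists_rejectionTime_eq_le {n : ℕ} (h : RejectCond c₀ δ x n) :
    ∃ N : ℕ, rejectionTime c₀ δ x = N ∧ N ≤ n := by
  have hle : rejectionTime c₀ δ x ≤ n := iInf₂_le n h
  obtain ⟨N, hN⟩ := ENat.ne_top_iff_exists.1 (ne_top_of_le_ne_top (ENat.natCast_ne_top n) hle)
  exact ⟨N, hN.symm, by rw [← hN] at hle; exact_mod_cast hle⟩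

end SequentialTester

theorem theorem5 :
    ∃ K : ℝ, 0 < K ∧
      ∀ {Ω : Type*} [MeasurableSpace Ω] (μ : Measure Ω) [IsProbabilityMeasure μ]
        (k : ℕ) (p : Fin k → ℝ) (_hp : p ∈ stdSimplex ℝ (Fin k))
        (X : ℕ → Ω → Fin k) (_hX : IsIIDSample p X μ)
        (c₀ δ : ℝ) (_hδ₀ : 0 < δ) (_hδ₁ : δ ≤ 1),
        (collisionProb p = c₀ →
          1 - δ ≤ μ.real {ω | SequentialTester.rejectionTime c₀ δ (fun i => X i ω) = ⊤}) ∧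
        (∀ ε : ℝ, 0 < ε → ε ≤ 1 → ε ≤ |collisionProb p - c₀| →
          1 - δ ≤ μ.real {ω | ∃ N : ℕ,
            SequentialTester.rejectionTime c₀ δ (fun i => X i ω) = (N : ℕ∞) ∧
            (N : ℝ) ≤ K * (1 / ε ^ 2 * max 1 (Real.log (Real.log (1 / ε))) *
              max 1 (Real.log (1 / δ)))}) := by
  refine ⟨1024, by norm_num, ?_⟩
  intro Ω _ μ _ k p _ X hX c₀ δ hδ₀ hδ₁
  have hconf := hX.one_sub_le_measure_forall_abs_sub_le_threshold hδ₀ hδ₁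
  refine ⟨fun hc => hconf.trans (measureReal_mono fun ω hω => ?_),
    fun ε hε₀ hε₁ hε => hconf.trans (measureReal_mono fun ω hω => ?_)⟩
  · refine SequentialTester.rejectionTime_eq_top_iff.2 fun n hn => ?_
    have h := hn.2
    rw [statistic_eq_collisionRate_sub _ _ hn.1, ← hc] at h
    exact (hω n hn.1).not_gt h
  · obtain ⟨n, hn, hthr, hnK⟩ := exists_two_mul_threshold_lt hδ₀ hε₀ hε₁
    have hrej : SequentialTester.RejectCond c₀ δ (fun i => X i ω) n := by
      refine ⟨hn, ?_⟩
      rw [statistic_eq_collisionRate_sub _ _ hn]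
      have h1 := hω n hn
      have h2 := abs_sub_le (collisionProb p) (collisionRate (fun i => X i ω) n) c₀
      rw [abs_sub_comm _ (collisionRate _ n)] at h2
      linarith
    obtain ⟨N, hN, hNn⟩ := SequentialTester.exists_rejectionTime_eq_le hrej
    exact ⟨N, hN, (Nat.cast_le.2 hNn).trans hnK⟩
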